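/- Let $\mathcal A$ be a unital $C^*$-algebra, $M$ a Hilbert $\mathcal A$-module, and $B^a(M)$ the algebra of bounded $\mathcal A$-linear adjointable operators on $M$. An operator $T\in B^a(M)$ is called Drazin invertible if there is some $q\in\mathbb N$ such that $\operatorname{Im}T^n$ is closed, $\operatorname{Im}T^n=\operatorname{Im}T^q$ and $\ker T^n=\ker T^q$ for all $n\ge q$. Let $F,D\in B^a(M)$ with $FD=DF$. Assume that $FD$ is Drazin invertible, and let $p\in\mathbb N$ be such that $\operatorname{Im}(FD)^n=\operatorname{Im}(FD)^p$ and $\ker(FD)^n=\ker(FD)^p$ for all $n\ge p$. Then $F$ is Drazin invertible if and only if there exist integers $s,t\ge 1$ and $k,k'$ with $p\le k\le k'$ such that $\operatorname{Im}F^k$ and $\operatorname{Im}F^{k+s}$ are closed, $$\operatorname{Im}F^k\cap\ker D^p=\operatorname{Im}F^{k+s}\cap\ker D^p,\qquad \operatorname{Im}(F^*)^{k'}\cap\ker (D^*)^p=\operatorname{Im}(F^*)^{k'+t}\cap\ker (D^*)^p .$$ -/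

import Mathlib

namespace HilbertCStar

section

variable (A M : Type*) [CStarAlgebra A] [PartialOrder A] [StarOrderedRing A]
  [NormedAddCommGroup M] [NormedSpace ℂ M] [Module A M] [CStarModule A M]

/-- The ring `Bᵃ(M)` of all bounded `A`-linear operators on the Hilbert `A`-module `M` that have
an adjoint with respect to the `A`-valued inner product. -/
def AdjointableOperators : Subring (M →L[A] M) where
  carrier := {F | ∃ G : M →L[A] M, ∀ x y : M, inner A (F x) y = inner A x (G y)}
  mul_mem' := by
    rintro F₁ F₂ ⟨G₁, h₁⟩ ⟨G₂, h₂⟩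
    exact ⟨G₂ * G₁, fun x y => by simp [h₁, h₂]⟩
  one_mem' := ⟨1, fun x y => by simp⟩
  add_mem' := by
    rintro F₁ F₂ ⟨G₁, h₁⟩ ⟨G₂, h₂⟩
    exact ⟨G₁ + G₂, fun x y => by simp [h₁, h₂]⟩
  zero_mem' := ⟨0, fun x y => by simp⟩
  neg_mem' := by
    rintro F ⟨G, h⟩
    exact ⟨-G, fun x y => by simp [h]⟩

end

section

variable {A M : Type*} [CStarAlgebra A] [PartialOrder A] [StarOrderedRing A]
  [NormedAddCommGroup M] [NormedSpace ℂ M] [Module A M] [CStarModule A M]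

/-- The adjoint `F*` of an adjointable operator `F`; it is characterized by
`AdjointableOperators.inner_star_right`. -/
noncomputable instance AdjointableOperators.instStar : Star (AdjointableOperators A M) where
  star F := ⟨F.2.choose, F.1, fun x y => by
    rw [← CStarModule.star_inner y, ← F.2.choose_spec y x, CStarModule.star_inner]⟩

theorem AdjointableOperators.inner_star_right (F : AdjointableOperators A M) (x y : M) :
    inner A x ((star F : AdjointableOperators A M).1 y) = inner A (F.1 x) y :=
  (F.2.choose_spec x y).symm

/-- The image of an adjointable operator. -/
def im (F : AdjointableOperators A M) : Submodule A M :=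
  LinearMap.range (F.1 : M →ₗ[A] M)

/-- The kernel of an adjointable operator. -/
def ker (F : AdjointableOperators A M) : Submodule A M :=
  LinearMap.ker (F.1 : M →ₗ[A] M)

/-- `F` is Drazin invertible: from some exponent on, the images of the powers of `F` are closed
and do not change, and neither do their kernels. -/
def IsDrazinInvertible (F : AdjointableOperators A M) : Prop :=
  ∃ p : ℕ, ∀ k : ℕ, p ≤ k →
    IsClosed (im (F ^ k) : Set M) ∧ im (F ^ k) = im (F ^ p) ∧ ker (F ^ k) = ker (F ^ p)

end

end HilbertCStar

set_option linter.unusedSectionVars false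

namespace HilbertCStar

section Banach

variable {E : Type*} [NormedAddCommGroup E] [NormedSpace ℝ E] [CompleteSpace E]

/-! Suppose the image criterion holds, and let `y = F ^ k x`. Since the images of `(F D) ^ n`
stabilize at `p`, there is `w` in `Im (F D) ^ (k + s)` with `(F D) ^ p (x - w) = 0`. As `p ≤ k`, `F
^ k (x - w)` lies in `ker D ^ p`, hence in `Im F ^ (k + s)`, and so does `F ^ k w`. Thus the images
of powers of `F` stabilize (`im_pow_eq_of_inf_ker_eq`).

Kernels follow from the same argument for adjoints, since `ker T = (Im T*)ᗮ`. Passing from kernels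
to images of adjoints needs `Im T* = (ker T)ᗮ` for closed range. Closed submodules of a Hilbert
module need not be complemented, so this rests on `Im T T* = Im T`: on `Im T`, the positive operator
`T T*` is bounded below, hence invertible. -/

/-- If `S + r` is bounded below, uniformly in `r ≥ 0`, then `S` is invertible. -/
theorem isUnit_of_forall_add_smul_bounded_below (S : E →L[ℝ] E) {c : ℝ} (hc : 0 < c)
    (h : ∀ r : ℝ, 0 ≤ r → ∀ x : E, c * ‖x‖ ≤ ‖S x + r • x‖) : IsUnit S := by
  -- Continuity method: start from `r > ‖S‖` and descend to `0` in steps of `c / 2`. Each inverse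
  -- has norm at most `1 / c`, so a step is a relative perturbation of norm at most `1 / 2`.
  have key : ∀ n : ℕ, ∀ r : ℝ, 0 ≤ r → ‖S‖ < r + n * (c / 2) →
      IsUnit (S + r • (1 : E →L[ℝ] E)) := by
    intro n
    induction n with
    | zero =>
      intro r hr hlt
      have hmem : -r ∈ resolventSet ℝ S := by
        refine spectrum.mem_resolventSet_of_norm_lt_mul ?_
        -- Only `‖1‖ ≤ 1` is available, because `E` may be trivial.
        calc ‖S‖ * ‖(1 : E →L[ℝ] E)‖ ≤ ‖S‖ * 1 := by
              gcongr
              exact ContinuousLinearMap.norm_id_le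
          _ < ‖-r‖ := by
              rw [norm_neg, Real.norm_of_nonneg hr]
              simpa using hlt
      rw [spectrum.mem_resolventSet_iff] at hmem
      have := hmem.neg
      rwa [Algebra.algebraMap_eq_smul_one, neg_smul, neg_sub, sub_neg_eq_add] at this
    | succ n ih =>
      intro r hr hlt
      obtain ⟨u, hu⟩ := ih (r + c / 2) (by positivity) (by push_cast at hlt; linarith)
      have hbound : ‖((u⁻¹ : (E →L[ℝ] E)ˣ) : E →L[ℝ] E)‖ ≤ c⁻¹ := by
        refine ContinuousLinearMap.opNorm_le_bound _ (by positivity) fun y => ?_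
        have hy := h (r + c / 2) (by positivity) ((u⁻¹ : (E →L[ℝ] E)ˣ).1 y)
        have hinv : (u : E →L[ℝ] E) ((u⁻¹ : (E →L[ℝ] E)ˣ).1 y) = y := by
          rw [← mul_apply_eq_comp, Units.mul_inv, one_apply_eq_self]
        rw [hu] at hinv
        have hinv' : S ((u⁻¹ : (E →L[ℝ] E)ˣ).1 y) +
            (r + c / 2) • ((u⁻¹ : (E →L[ℝ] E)ˣ).1 y) = y := hinv
        rw [hinv'] at hy
        rwa [inv_mul_eq_div, le_div_iff₀' hc]
      have hnear : IsUnit (1 - (c / 2) • ((u⁻¹ : (E →L[ℝ] E)ˣ) : E →L[ℝ] E)) := by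
        refine isUnit_one_sub_of_norm_lt_one ?_
        calc _ ≤ c / 2 * c⁻¹ := by
              rw [norm_smul, Real.norm_of_nonneg (by positivity)]
              gcongr
          _ < 1 := by
              field_simp
              norm_num
      have := u.isUnit.mul hnear
      rw [mul_sub, mul_smul_comm, Units.mul_inv, mul_one, hu, add_smul] at this
      convert this using 1
      abel
  obtain ⟨n, hn⟩ := exists_nat_gt (‖S‖ / (c / 2))
  rw [div_lt_iff₀ (by positivity)] at hn
  simpa using key n 0 le_rfl (by simpa using hn)

end Banach

/-! ### Closed range operators on Hilbert modules -/

section Module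

variable {A M : Type*} [CStarAlgebra A] [PartialOrder A] [StarOrderedRing A]
  [NormedAddCommGroup M] [NormedSpace ℂ M] [Module A M] [CStarModule A M]

variable (A) in
theorem eq_zero_of_inner_self_eq_zero {x : M} (h : inner A x x = 0) : x = 0 :=
  CStarModule.inner_self.mp h

/-- A positive operator only gets larger when a nonnegative multiple of the identity is added. -/
theorem norm_le_norm_add_smul {x y : M} (hxy : 0 ≤ inner A x y) {r : ℝ} (hr : 0 ≤ r) :
    ‖y‖ ≤ ‖y + r • x‖ := by
  have hyx : inner A y x = inner A x y := by
    rw [← CStarModule.star_inner x y]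
    exact IsSelfAdjoint.of_nonneg hxy
  refine (pow_le_pow_iff_left₀ (norm_nonneg _) (norm_nonneg _) two_ne_zero).mp ?_
  rw [CStarModule.norm_sq_eq A, CStarModule.norm_sq_eq A]
  refine CStarAlgebra.norm_le_norm_of_nonneg_of_le CStarModule.inner_self_nonneg ?_
  have hexp : inner A (y + r • x) (y + r • x) =
      inner A y y + ((2 * r) • inner A x y + (r * r) • inner A x x) := by
    simp only [CStarModule.inner_add_left, CStarModule.inner_add_right,
      CStarModule.inner_smul_left_real, CStarModule.inner_smul_right_real, hyx]
    module
  rw [hexp]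
  exact le_add_of_nonneg_right (add_nonneg (smul_nonneg (by positivity) hxy)
    (smul_nonneg (by positivity) CStarModule.inner_self_nonneg))

variable [CompleteSpace M]

/-- If `T` has closed range and adjoint `T'`, then `T` and `T T'` have the same range. -/
theorem exists_apply_apply_eq_of_isClosed_range (T T' : M →L[A] M)
    (hadj : ∀ x y : M, inner A (T x) y = inner A x (T' y))
    (hcl : IsClosed (Set.range T)) (x : M) : ∃ y : M, T (T' y) = T x := by
  -- Continuous additive maps are real linear, so Banach space theory applies over `ℝ`.
  let L : M →L[ℝ] M := (T : M →+ M).toRealLinearMap T.continuous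
  let L' : M →L[ℝ] M := (T' : M →+ M).toRealLinearMap T'.continuous
  have hL : ∀ x, L x = T x := fun _ => rfl
  have hL' : ∀ x, L' x = T' x := fun _ => rfl
  let R : Submodule ℝ M := L.range
  have hR : IsClosed (R : Set M) := by
    have : (R : Set M) = Set.range T := by
      ext; simp [R, hL]
    rwa [this]
  have : CompleteSpace R := hR.completeSpace_coe
  -- The open mapping theorem gives preimages under `T` with norm control `C`.
  obtain ⟨C, hC, hpre⟩ := ContinuousLinearMap.exists_preimage_norm_le L.rangeRestrict
    (by rintro ⟨_, x, rfl⟩; exact ⟨x, rfl⟩)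
  -- `T'` is bounded below on the range of `T`.
  have hT' : ∀ y : R, ‖(y : M)‖ ≤ C * ‖T' y‖ := by
    intro y
    obtain ⟨z, hz, hzn⟩ := hpre y
    have hz' : T z = y := congrArg Subtype.val hz
    have h1 : ‖(y : M)‖ * ‖(y : M)‖ ≤ ‖(y : M)‖ * (C * ‖T' y‖) := by
      calc ‖(y : M)‖ * ‖(y : M)‖ = ‖inner A (y : M) (y : M)‖ := by
            rw [← CStarModule.norm_sq_eq A, sq]
        _ = ‖inner A z (T' y)‖ := by rw [← hadj, hz']
        _ ≤ ‖z‖ * ‖T' y‖ := CStarModule.norm_inner_le M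
        _ ≤ (C * ‖(y : M)‖) * ‖T' y‖ := by
            gcongr
            exact hzn
        _ = ‖(y : M)‖ * (C * ‖T' y‖) := by ring
    rcases (norm_nonneg (y : M)).eq_or_lt with h0 | h0
    · rw [← h0]; positivity
    · exact le_of_mul_le_mul_left h1 h0
  have hTT' : ∀ y : R, ‖T' y‖ ≤ C * ‖T (T' y)‖ := by
    intro y
    have h1 : ‖T' y‖ * ‖T' y‖ ≤ ‖T' y‖ * (C * ‖T (T' y)‖) := by
      calc ‖T' y‖ * ‖T' y‖ = ‖inner A (T' y) (T' y)‖ := by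
            rw [← CStarModule.norm_sq_eq A, sq]
        _ = ‖inner A (T (T' y)) (y : M)‖ := by rw [hadj]
        _ ≤ ‖T (T' y)‖ * ‖(y : M)‖ := CStarModule.norm_inner_le M
        _ ≤ ‖T (T' y)‖ * (C * ‖T' y‖) := by
            gcongr
            exact hT' y
        _ = ‖T' y‖ * (C * ‖T (T' y)‖) := by ring
    rcases (norm_nonneg (T' y)).eq_or_lt with h0 | h0
    · rw [← h0]; positivity
    · exact le_of_mul_le_mul_left h1 h0
  let S : R →L[ℝ] R := L.rangeRestrict.comp (L'.comp R.subtypeL)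
  have hS : ∀ y : R, ((S y : R) : M) = T (T' y) := fun _ => rfl
  have hunit : IsUnit S := by
    refine isUnit_of_forall_add_smul_bounded_below S (c := (C * C)⁻¹) (by positivity) ?_
    intro r hr y
    have hpos : 0 ≤ inner A (y : M) (T (T' y)) := by
      have : inner A (y : M) (T (T' y)) = inner A (T' y) (T' y) := by
        rw [← CStarModule.star_inner, hadj, CStarModule.star_inner]
      rw [this]
      exact CStarModule.inner_self_nonneg
    have h1 : ‖(y : M)‖ ≤ (C * C) * ‖T (T' y)‖ := by
      calc ‖(y : M)‖ ≤ C * ‖T' y‖ := hT' y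
        _ ≤ C * (C * ‖T (T' y)‖) := by
            gcongr
            exact hTT' y
        _ = _ := by ring
    calc (C * C)⁻¹ * ‖y‖ ≤ ‖T (T' y)‖ := by
          rw [inv_mul_le_iff₀ (by positivity)]
          exact h1
      _ ≤ ‖T (T' y) + r • (y : M)‖ := norm_le_norm_add_smul hpos hr
      _ = ‖S y + r • y‖ := rfl
  obtain ⟨y, hy⟩ := (ContinuousLinearMap.isUnit_iff_bijective.mp hunit).2 ⟨T x, x, rfl⟩
  exact ⟨y, congrArg Subtype.val hy⟩

/-- If `T` has closed range and adjoint `T'`, then the range of `T'` is the orthogonal complement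
of the kernel of `T`. -/
theorem mem_range_iff_forall_inner_eq_zero_of_isClosed_range (T T' : M →L[A] M)
    (hadj : ∀ x y : M, inner A (T x) y = inner A x (T' y))
    (hcl : IsClosed (Set.range T)) (z : M) :
    z ∈ Set.range T' ↔ ∀ x : M, T x = 0 → inner A x z = 0 := by
  constructor
  · rintro ⟨y, rfl⟩ x hx
    rw [← hadj, hx, CStarModule.inner_zero_left]
  · intro hz
    obtain ⟨y, hy⟩ := exists_apply_apply_eq_of_isClosed_range T T' hadj hcl z
    have hker : T (z - T' y) = 0 := by rw [map_sub, hy, sub_self]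
    have h0 : inner A (z - T' y) (z - T' y) = 0 := by
      rw [CStarModule.inner_sub_right, hz _ hker, ← hadj, hker, CStarModule.inner_zero_left,
        sub_self]
    exact ⟨y, (sub_eq_zero.mp (eq_zero_of_inner_self_eq_zero A h0)).symm⟩

end Module

/-! ### Images and kernels of powers and adjoints -/

namespace AdjointableOperators

variable {A M : Type*} [CStarAlgebra A] [PartialOrder A] [StarOrderedRing A]
  [NormedAddCommGroup M] [NormedSpace ℂ M] [Module A M] [CStarModule A M]

theorem mem_im {F : AdjointableOperators A M} {y : M} : y ∈ im F ↔ ∃ x, F.1 x = y :=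
  LinearMap.mem_range

theorem mem_ker {F : AdjointableOperators A M} {x : M} : x ∈ ker F ↔ F.1 x = 0 :=
  LinearMap.mem_ker

theorem mul_val_apply (F G : AdjointableOperators A M) (x : M) : (F * G).1 x = F.1 (G.1 x) :=
  rfl

/-- Adjoints are unique because the inner product is definite; this frees `star` from the choice in
its definition. -/
theorem star_eq_of_inner_eq {F G : AdjointableOperators A M}
    (h : ∀ x y : M, inner A (F.1 x) y = inner A x (G.1 y)) : star F = G := by
  refine Subtype.ext (ContinuousLinearMap.ext fun y => sub_eq_zero.mp ?_)
  refine eq_zero_of_inner_self_eq_zero A ?_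
  rw [CStarModule.inner_sub_right, inner_star_right, h, sub_self]

theorem star_mul_eq (F G : AdjointableOperators A M) : star (F * G) = star G * star F :=
  star_eq_of_inner_eq fun x y => by
    rw [mul_val_apply, mul_val_apply, inner_star_right, inner_star_right]

theorem star_pow_eq (F : AdjointableOperators A M) (n : ℕ) : star (F ^ n) = star F ^ n := by
  induction n with
  | zero => exact star_eq_of_inner_eq fun x y => rfl
  | succ n ih => rw [pow_succ, star_mul_eq, ih, pow_succ']

theorem mem_ker_iff_forall_inner_star (F : AdjointableOperators A M) (x : M) :
    x ∈ ker F ↔ ∀ y ∈ im (star F), inner A x y = 0 := by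
  rw [mem_ker]
  constructor
  · rintro hx _ ⟨y, rfl⟩
    change inner A x ((star F : AdjointableOperators A M).1 y) = 0
    rw [inner_star_right, hx, CStarModule.inner_zero_left]
  · intro h
    refine eq_zero_of_inner_self_eq_zero A ?_
    rw [← inner_star_right]
    exact h _ (mem_im.mpr ⟨_, rfl⟩)

theorem ker_eq_of_im_star_eq {F G : AdjointableOperators A M} (h : im (star F) = im (star G)) :
    ker F = ker G := by
  ext x
  rw [mem_ker_iff_forall_inner_star, mem_ker_iff_forall_inner_star, h]

/-- Closed range makes each `Im T*` the full orthogonal complement of `ker T`; the converse passage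
`ker_eq_of_im_star_eq` needs no closedness. -/
theorem im_star_eq_of_ker_eq [CompleteSpace M] {F G : AdjointableOperators A M}
    (hF : IsClosed (im F : Set M)) (hG : IsClosed (im G : Set M)) (h : ker F = ker G) :
    im (star F) = im (star G) := by
  have key : ∀ H : AdjointableOperators A M, IsClosed (im H : Set M) → ∀ z : M,
      z ∈ im (star H) ↔ ∀ x ∈ ker H, inner A x z = 0 := fun H hH z =>
    mem_range_iff_forall_inner_eq_zero_of_isClosed_range H.1 (star H : AdjointableOperators A M).1
      (fun x y => (inner_star_right H x y).symm) (by rwa [im, LinearMap.coe_range] at hH) z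
  ext z
  rw [key F hF, key G hG, h]

theorem im_pow_le_im_pow (F : AdjointableOperators A M) {m n : ℕ} (h : m ≤ n) :
    im (F ^ n) ≤ im (F ^ m) := by
  rintro _ ⟨x, rfl⟩
  obtain ⟨d, rfl⟩ := Nat.exists_eq_add_of_le h
  refine mem_im.mpr ⟨(F ^ d).1 x, ?_⟩
  rw [← mul_val_apply, ← pow_add]
  rfl

/-- The images decrease, so `Im F ^ (k + 1)` is squeezed between two equal ones; applying `F`
propagates the equality. -/
theorem im_pow_eq_of_im_pow_add_eq {F : AdjointableOperators A M} {k s : ℕ} (hs : 1 ≤ s)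
    (h : im (F ^ (k + s)) = im (F ^ k)) {n : ℕ} (hn : k ≤ n) : im (F ^ n) = im (F ^ k) := by
  have hsucc : ∀ m, im (F ^ (k + m)) = im (F ^ k) := by
    intro m
    induction m with
    | zero => rfl
    | succ m ih =>
      refine le_antisymm (im_pow_le_im_pow F (by lia)) ?_
      intro y hy
      rw [← h] at hy
      obtain ⟨x, rfl⟩ := mem_im.mp (im_pow_le_im_pow F (show k + 1 ≤ k + s by lia) hy)
      have hx : (F ^ k).1 x ∈ im (F ^ (k + m)) := ih ▸ mem_im.mpr ⟨x, rfl⟩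
      obtain ⟨z, hz⟩ := mem_im.mp hx
      refine mem_im.mpr ⟨z, ?_⟩
      rw [← add_assoc, pow_succ', mul_val_apply, hz, pow_succ', mul_val_apply]
  obtain ⟨m, rfl⟩ := Nat.exists_eq_add_of_le hn
  exact hsucc m

/-- If `F` and `D` commute and the images of the powers of `F D` stabilize at `p`, then the images
of two powers of `F` agree as soon as their intersections with `ker D ^ p` do. -/
theorem im_pow_eq_of_inf_ker_eq {F D : AdjointableOperators A M} (hcomm : Commute F D) {p k s : ℕ}
    (hp : ∀ n, p ≤ n → im ((F * D) ^ n) = im ((F * D) ^ p)) (hk : p ≤ k)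
    (h : im (F ^ k) ⊓ ker (D ^ p) = im (F ^ (k + s)) ⊓ ker (D ^ p)) :
    im (F ^ (k + s)) = im (F ^ k) := by
  refine le_antisymm (im_pow_le_im_pow F (by lia)) ?_
  intro _ hy
  obtain ⟨x, rfl⟩ := mem_im.mp hy
  have hx : ((F * D) ^ p).1 x ∈ im ((F * D) ^ (p + (k + s))) := by
    rw [hp _ (by lia)]
    exact mem_im.mpr ⟨x, rfl⟩
  obtain ⟨u, hu⟩ := mem_im.mp hx
  rw [pow_add, mul_val_apply] at hu
  set w := ((F * D) ^ (k + s)).1 u with hw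
  have hker : ((F * D) ^ p).1 (x - w) = 0 := by rw [map_sub, hu, sub_self]
  have hmem : (F ^ k).1 (x - w) ∈ im (F ^ k) ⊓ ker (D ^ p) := by
    refine ⟨mem_im.mpr ⟨_, rfl⟩, mem_ker.mpr ?_⟩
    -- Here `p ≤ k` is essential: `F ^ k` must supply the `p` factors paired with `D ^ p`.
    have hop : D ^ p * F ^ k = F ^ (k - p) * (F * D) ^ p := by
      rw [hcomm.mul_pow, ← mul_assoc, ← pow_add, Nat.sub_add_cancel hk]
      exact (hcomm.pow_pow k p).symm.eq
    rw [← mul_val_apply, hop, mul_val_apply, hker, map_zero]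
  rw [h] at hmem
  have hw' : (F ^ k).1 w ∈ im (F ^ (k + s)) := by
    refine mem_im.mpr ⟨(F ^ k * D ^ (k + s)).1 u, ?_⟩
    have hop : F ^ (k + s) * (F ^ k * D ^ (k + s)) = F ^ k * (F * D) ^ (k + s) := by
      rw [hcomm.mul_pow, ← mul_assoc, ← mul_assoc, ← pow_add, ← pow_add, add_comm k (k + s)]
    rw [← mul_val_apply, hop, mul_val_apply]
  have := add_mem hmem.1 hw'
  rwa [← map_add, sub_add_cancel] at this

end AdjointableOperators

end HilbertCStar

open HilbertCStar HilbertCStar.AdjointableOperators in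
theorem mainTheorem3 {A M : Type*} [CStarAlgebra A] [PartialOrder A] [StarOrderedRing A]
    [NormedAddCommGroup M] [NormedSpace ℂ M] [CompleteSpace M] [Module A M] [CStarModule A M]
    (F D : HilbertCStar.AdjointableOperators A M) (hcomm : F * D = D * F)
    (hFD : HilbertCStar.IsDrazinInvertible (F * D)) (p : ℕ)
    (hp : ∀ n : ℕ, p ≤ n →
      HilbertCStar.im ((F * D) ^ n) = HilbertCStar.im ((F * D) ^ p) ∧
        HilbertCStar.ker ((F * D) ^ n) = HilbertCStar.ker ((F * D) ^ p)) :
    HilbertCStar.IsDrazinInvertible F ↔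
      ∃ s t k k' : ℕ, 1 ≤ s ∧ 1 ≤ t ∧ p ≤ k ∧ k ≤ k' ∧
        IsClosed (HilbertCStar.im (F ^ k) : Set M) ∧
        IsClosed (HilbertCStar.im (F ^ (k + s)) : Set M) ∧
        HilbertCStar.im (F ^ k) ⊓ HilbertCStar.ker (D ^ p) =
          HilbertCStar.im (F ^ (k + s)) ⊓ HilbertCStar.ker (D ^ p) ∧
        HilbertCStar.im (star F ^ k') ⊓ HilbertCStar.ker (star D ^ p) =
          HilbertCStar.im (star F ^ (k' + t)) ⊓ HilbertCStar.ker (star D ^ p) := by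
  constructor
  · rintro ⟨q, hq⟩
    have hk := hq (max p q) (le_max_right _ _)
    have hk1 := hq (max p q + 1) (by lia)
    have him : im (F ^ max p q) = im (F ^ (max p q + 1)) := hk.2.1.trans hk1.2.1.symm
    refine ⟨1, 1, max p q, max p q, le_rfl, le_rfl, le_max_left _ _, le_rfl, hk.1, hk1.1,
      by rw [him], ?_⟩
    rw [← star_pow_eq F, ← star_pow_eq F,
      im_star_eq_of_ker_eq hk.1 hk1.1 (hk.2.2.trans hk1.2.2.symm)]
  · rintro ⟨s, t, k, k', hs, ht, hpk, hkk', hcl, -, h, h'⟩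
    -- The exponent `q` from Drazin invertibility may exceed `p`, but the image is already constant
    -- from `p` on.
    have hclosed : ∀ n, p ≤ n → IsClosed (im ((F * D) ^ n) : Set M) := by
      obtain ⟨q, hq⟩ := hFD
      intro n hn
      rw [(hp n hn).1, ← (hp (max p q) (le_max_left _ _)).1]
      exact (hq _ (le_max_right _ _)).1
    have hstar : star (F * D) = star F * star D := by rw [hcomm, star_mul_eq]
    have hcomm' : Commute (star F) (star D) := by
      rw [Commute, SemiconjBy, ← hstar, star_mul_eq]
    have hp' : ∀ n, p ≤ n → im ((star F * star D) ^ n) = im ((star F * star D) ^ p) := by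
      intro n hn
      rw [← hstar, ← star_pow_eq, ← star_pow_eq]
      exact im_star_eq_of_ker_eq (hclosed n hn) (hclosed p le_rfl) (hp n hn).2
    have him : ∀ n, k ≤ n → im (F ^ n) = im (F ^ k) := fun n hn =>
      im_pow_eq_of_im_pow_add_eq hs
        (im_pow_eq_of_inf_ker_eq hcomm (fun n hn => (hp n hn).1) hpk h) hn
    have him' : ∀ n, k' ≤ n → im (star F ^ n) = im (star F ^ k') := fun n hn =>
      im_pow_eq_of_im_pow_add_eq ht
        (im_pow_eq_of_inf_ker_eq hcomm' hp' (hpk.trans hkk') h') hn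
    -- Images are constant from `k` and kernels from `k'`; as `k ≤ k'`, the exponent `k'` serves
    -- both.
    refine ⟨k', fun n hn => ⟨?_, ?_, ?_⟩⟩
    · rw [him n (hkk'.trans hn)]
      exact hcl
    · rw [him n (hkk'.trans hn), him k' hkk']
    · refine ker_eq_of_im_star_eq ?_
      rw [star_pow_eq, star_pow_eq, him' n hn]
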